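/- Let $p$ be a prime, $g\ge 1$, $q=p^g$, let $\mathbb F_q$ be a field with $q$ elements, $\sigma:x\mapsto x^p$ its Frobenius automorphism, and $G=GL_2(\mathbb F_q)$. Let $K_0(G)$ be the Grothendieck group of finitely generated $\mathbb F_q[G]$-modules (generated by classes $[M]$, with $[B]=[A]+[C]$ for every short exact sequence $0\to A\to B\to C\to 0$), a commutative ring under $[M][N]=[M\otimes_{\mathbb F_q}N]$, and let $e=[\det]\in K_0(G)^\times$. For $k\ge 0$ let $M_k\in K_0(G)$ be the class of $\mathrm{Sym}^k\mathbb F_q^2$, that is, of the space of homogeneous polynomials of degree $k$ in $\mathbb F_q[X,Y]$ with action $\begin{pmatrix}a&b\\c&d\end{pmatrix}X=aX+cY$, $\begin{pmatrix}a&b\\c&d\end{pmatrix}Y=bX+dY$; put $M_{-1}=0$ and $M_k=-e^{1+k}M_{-k-2}$ for $k\le -2$. For $i\in\mathbb Z$ let $x\mapsto x^{[i]}$ be the ring endomorphism of $K_0(G)$ induced by restricting the action along the automorphism of $G$ that applies $\sigma^i$ to every matrix entry. For $n\in\mathbb Z$ the element $e^{p^{n}}$ is understood as $e^{p^m}$ for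 any integer $m\ge 0$ with $m\equiv n\pmod g$; it does not depend on $m$, since $e^{q-1}=1$. Then for all $k,h,i\in\mathbb Z$ the following identity holds in $K_0(G)$: $$M_k^{[i]}M_h^{[i+1]}-e^{p^{i+1}}M_{k-p}^{[i]}M_{h-1}^{[i+1]}=M_{k-p}^{[i]}M_{h+1}^{[i+1]}-e^{p^{i+1}}M_{k-2p}^{[i]}M_h^{[i+1]}.$$ -/

import Mathlib

open scoped TensorProduct MatrixGroups

noncomputable section

universe u v w

namespace ModularRep

/-! ## The Grothendieck ring of finite-dimensional representations -/

/-- A finite-dimensional representation of `G` over the field `k`, that is, a finitely generated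
`k[G]`-module when `G` is finite. -/
structure FinRep (k : Type u) [Field k] (G : Type v) [Monoid G] where
  /-- the underlying space -/
  V : Type u
  [addCommGroup : AddCommGroup V]
  [module : Module k V]
  [finite : Module.Finite k V]
  /-- the action -/
  ρ : Representation k G V

attribute [instance] FinRep.addCommGroup FinRep.module FinRep.finite

section General

variable {k : Type u} [Field k] {G : Type v} [Monoid G]

/-- There is a short exact sequence `0 → A → B → C → 0` of representations. -/
def IsExtension (A B C : FinRep k G) : Prop :=
  ∃ (f : A.ρ.IntertwiningMap B.ρ) (g : B.ρ.IntertwiningMap C.ρ),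
    Function.Injective f ∧ Function.Exact f g ∧ Function.Surjective g

variable (k G) in
/-- The relations `[B] - ([A] + [C])`, one for every short exact sequence `0 → A → B → C → 0`. -/
def exactRelations : Set (FreeAbelianGroup (FinRep k G)) :=
  {x | ∃ A B C : FinRep k G, IsExtension A B C ∧
    x = FreeAbelianGroup.of B - (FreeAbelianGroup.of A + FreeAbelianGroup.of C)}

variable (k G) in
/-- The Grothendieck group `K₀` of finite-dimensional representations of `G` over `k`. -/
def K0 : Type (max (u + 1) v) :=
  FreeAbelianGroup (FinRep k G) ⧸ AddSubgroup.closure (exactRelations k G)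

instance : AddCommGroup (K0 k G) :=
  inferInstanceAs (AddCommGroup (_ ⧸ AddSubgroup.closure (exactRelations k G)))

/-- The class `[A]` of a representation. -/
def cl (A : FinRep k G) : K0 k G :=
  QuotientAddGroup.mk' (AddSubgroup.closure (exactRelations k G)) (FreeAbelianGroup.of A)

theorem cl_of_isExtension {A B C : FinRep k G} (h : IsExtension A B C) :
    cl B = cl A + cl C := by
  have hmem : FreeAbelianGroup.of B - (FreeAbelianGroup.of A + FreeAbelianGroup.of C) ∈
      AddSubgroup.closure (exactRelations k G) :=
    AddSubgroup.subset_closure ⟨A, B, C, h, rfl⟩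
  have h0 := (QuotientAddGroup.eq_zero_iff _).2 hmem
  exact sub_eq_zero.1 h0

/-- Additive functions on representations factor through `K0`. -/
def K0.lift {H : Type w} [AddCommGroup H] (φ : FinRep k G → H)
    (hφ : ∀ A B C, IsExtension A B C → φ B = φ A + φ C) : K0 k G →+ H :=
  QuotientAddGroup.lift _ (FreeAbelianGroup.lift φ) (by
    rw [AddSubgroup.closure_le]
    rintro x ⟨A, B, C, h, rfl⟩
    simp [hφ A B C h])

@[simp]
theorem K0.lift_cl {H : Type w} [AddCommGroup H] (φ : FinRep k G → H)
    (hφ : ∀ A B C, IsExtension A B C → φ B = φ A + φ C) (A : FinRep k G) :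
    K0.lift φ hφ (cl A) = φ A :=
  FreeAbelianGroup.lift_apply_of φ A

theorem K0.induction {P : K0 k G → Prop} (hcl : ∀ A, P (cl A))
    (hadd : ∀ x y, P x → P y → P (x + y)) (hneg : ∀ x, P x → P (-x)) (x : K0 k G) : P x := by
  obtain ⟨x, rfl⟩ := QuotientAddGroup.mk'_surjective _ x
  induction x using FreeAbelianGroup.induction_on with
  | zero =>
    have h := hadd _ _ (hcl ⟨PUnit, 1⟩) (hneg _ (hcl ⟨PUnit, 1⟩))
    rw [add_neg_cancel] at h
    exact h
  | of A => exact hcl A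
  | neg A _ => exact hneg _ (hcl A)
  | add x y hx hy => exact hadd _ _ hx hy

theorem K0.hom_ext {H : Type w} [AddCommGroup H] {f g : K0 k G →+ H}
    (h : ∀ A, f (cl A) = g (cl A)) : f = g := by
  ext x
  induction x using K0.induction with
  | hcl A => exact h A
  | hadd x y hx hy => rw [map_add, map_add, hx, hy]
  | hneg x hx => rw [map_neg, map_neg, hx]

theorem cl_eq_of_equiv {A B : FinRep k G} (e : A.ρ.Equiv B.ρ) : cl A = cl B := by
  have hz : cl (⟨PUnit, 1⟩ : FinRep k G) = 0 := by
    have h : IsExtension (⟨PUnit, 1⟩ : FinRep k G) ⟨PUnit, 1⟩ ⟨PUnit, 1⟩ :=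
      ⟨0, 0, fun _ _ _ => Subsingleton.elim _ _,
        fun y => ⟨fun _ => ⟨y, Subsingleton.elim _ _⟩, fun _ => Subsingleton.elim _ _⟩,
        fun y => ⟨y, Subsingleton.elim _ _⟩⟩
    simpa using cl_of_isExtension h
  have h : IsExtension A B (⟨PUnit, 1⟩ : FinRep k G) :=
    ⟨e.toIntertwiningMap, 0, e.toLinearEquiv.injective,
      fun y => ⟨fun _ => e.toLinearEquiv.surjective y, fun _ => Subsingleton.elim _ _⟩,
      fun y => ⟨0, Subsingleton.elim _ _⟩⟩
  rw [cl_of_isExtension h, hz, add_zero]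

/-- The tensor product of representations. -/
def FinRep.tensor (A B : FinRep k G) : FinRep k G :=
  ⟨A.V ⊗[k] B.V, A.ρ.tprod B.ρ⟩

/-- The representation on `k` given by a character. -/
def FinRep.ofChar (χ : G →* kˣ) : FinRep k G where
  V := k
  ρ :=
    { toFun := fun g => ((χ g : kˣ) : k) • LinearMap.id
      map_one' := by ext; simp
      map_mul' := fun g h => by ext; simp [mul_comm] }

variable (k G) in
/-- The trivial representation on `k`. -/
def FinRep.one : FinRep k G := ⟨k, Representation.trivial k G k⟩

theorem IsExtension.tensor_left (X : FinRep k G) {A B C : FinRep k G} (h : IsExtension A B C) :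
    IsExtension (X.tensor A) (X.tensor B) (X.tensor C) := by
  obtain ⟨f, g, hf, hfg, hg⟩ := h
  refine ⟨Representation.IntertwiningMap.lTensor X.ρ f,
    Representation.IntertwiningMap.lTensor X.ρ g, ?_, ?_, ?_⟩
  · exact Module.Flat.lTensor_preserves_injective_linearMap (M := X.V) f.toLinearMap hf
  · exact lTensor_exact X.V (f := f.toLinearMap) (g := g.toLinearMap) hfg hg
  · exact LinearMap.lTensor_surjective X.V (g := g.toLinearMap) hg

theorem cl_tensor_comm (A B : FinRep k G) : cl (A.tensor B) = cl (B.tensor A) :=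
  cl_eq_of_equiv (A := A.tensor B) (B := B.tensor A) (Representation.TensorProduct.comm A.ρ B.ρ)

/-- The biadditive product on `K0` with `[A] * [B] = [A ⊗ B]`. -/
def K0.mulHom : K0 k G →+ K0 k G →+ K0 k G :=
  K0.lift
    (fun A => K0.lift (fun B => cl (A.tensor B))
      (fun _ _ _ h => cl_of_isExtension (h.tensor_left A)))
    (fun A B C h => K0.hom_ext fun X => by
      simp only [K0.lift_cl, AddMonoidHom.add_apply]
      rw [cl_tensor_comm A, cl_tensor_comm B, cl_tensor_comm C]
      exact cl_of_isExtension (h.tensor_left X))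

instance : Mul (K0 k G) := ⟨fun x y => K0.mulHom x y⟩

instance : One (K0 k G) := ⟨cl (FinRep.one k G)⟩

theorem K0.one_def : (1 : K0 k G) = cl (FinRep.one k G) := rfl

theorem K0.mul_def (x y : K0 k G) : x * y = K0.mulHom x y := rfl

theorem cl_mul_cl (A B : FinRep k G) : cl A * cl B = cl (A.tensor B) := by
  simp [K0.mul_def, K0.mulHom]

protected theorem K0.add_mul' (x y z : K0 k G) : (x + y) * z = x * z + y * z := by
  simp [K0.mul_def]

protected theorem K0.mul_add' (x y z : K0 k G) : x * (y + z) = x * y + x * z := by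
  simp [K0.mul_def]

protected theorem K0.neg_mul' (x y : K0 k G) : -x * y = -(x * y) := by
  simp [K0.mul_def]

protected theorem K0.mul_neg' (x y : K0 k G) : x * -y = -(x * y) := by
  simp [K0.mul_def]

protected theorem K0.mul_comm' (x y : K0 k G) : x * y = y * x := by
  induction x using K0.induction with
  | hadd x x' hx hx' => rw [K0.add_mul', K0.mul_add', hx, hx']
  | hneg x hx => rw [K0.neg_mul', K0.mul_neg', hx]
  | hcl A =>
    induction y using K0.induction with
    | hadd y y' hy hy' => rw [K0.add_mul', K0.mul_add', hy, hy']
    | hneg y hy => rw [K0.neg_mul', K0.mul_neg', hy]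
    | hcl B => rw [cl_mul_cl, cl_mul_cl, cl_tensor_comm]

protected theorem K0.one_mul' (x : K0 k G) : 1 * x = x := by
  induction x using K0.induction with
  | hadd x y hx hy => rw [K0.mul_add', hx, hy]
  | hneg x hx => rw [K0.mul_neg', hx]
  | hcl A =>
    rw [K0.one_def, cl_mul_cl]
    exact cl_eq_of_equiv (A := (FinRep.one k G).tensor A) (Representation.TensorProduct.lid k A.ρ)

protected theorem K0.mul_assoc' (x y z : K0 k G) : x * y * z = x * (y * z) := by
  induction x using K0.induction with
  | hadd x x' hx hx' => simp only [K0.add_mul', hx, hx']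
  | hneg x hx => simp only [K0.neg_mul', hx]
  | hcl A =>
    induction y using K0.induction with
    | hadd y y' hy hy' => simp only [K0.add_mul', K0.mul_add', hy, hy']
    | hneg y hy => simp only [K0.neg_mul', K0.mul_neg', hy]
    | hcl B =>
      induction z using K0.induction with
      | hadd z z' hz hz' => simp only [K0.mul_add', hz, hz']
      | hneg z hz => simp only [K0.mul_neg', hz]
      | hcl C =>
        simp only [cl_mul_cl]
        exact cl_eq_of_equiv (A := (A.tensor B).tensor C) (B := A.tensor (B.tensor C))
          (Representation.TensorProduct.assoc A.ρ B.ρ C.ρ)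

/-- `K0 k G` is a commutative ring, with product induced by the tensor product over `k`. -/
instance : CommRing (K0 k G) :=
  { (inferInstance : AddCommGroup (K0 k G)), (inferInstance : Mul (K0 k G)),
    (inferInstance : One (K0 k G)) with
    left_distrib := K0.mul_add'
    right_distrib := K0.add_mul'
    zero_mul := fun x => by simp [K0.mul_def]
    mul_zero := fun x => by simp [K0.mul_def]
    mul_assoc := K0.mul_assoc'
    one_mul := K0.one_mul'
    mul_one := fun x => by rw [K0.mul_comm', K0.one_mul']
    mul_comm := K0.mul_comm' }

/-- The restriction of a representation along a homomorphism. -/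
def FinRep.res {H : Type w} [Monoid H] (φ : H →* G) (A : FinRep k G) : FinRep k H :=
  ⟨A.V, A.ρ.comp φ⟩

theorem IsExtension.res {H : Type w} [Monoid H] (φ : H →* G) {A B C : FinRep k G}
    (h : IsExtension A B C) : IsExtension (A.res φ) (B.res φ) (C.res φ) := by
  obtain ⟨f, g, hf, hfg, hg⟩ := h
  exact ⟨⟨f.toLinearMap, fun x => f.isIntertwining' (φ x)⟩,
    ⟨g.toLinearMap, fun x => g.isIntertwining' (φ x)⟩, hf, hfg, hg⟩

/-- The ring homomorphism of Grothendieck rings with `[A] ↦ [A.res φ]`. -/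
def K0.res {H : Type w} [Monoid H] (φ : H →* G) : K0 k G →+* K0 k H where
  toFun := K0.lift (fun A => cl (A.res φ)) (fun _ _ _ h => cl_of_isExtension (h.res φ))
  map_zero' := map_zero _
  map_add' := map_add _
  map_one' := by
    rw [K0.one_def, K0.lift_cl]
    rfl
  map_mul' x y := by
    induction x using K0.induction with
    | hadd x x' hx hx' => rw [add_mul, map_add, hx, hx', map_add, add_mul]
    | hneg x hx => rw [neg_mul, map_neg, hx, map_neg, neg_mul]
    | hcl A =>
      induction y using K0.induction with
      | hadd y y' hy hy' => rw [mul_add, map_add, hy, hy', map_add, mul_add]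
      | hneg y hy => rw [mul_neg, map_neg, hy, map_neg, mul_neg]
      | hcl B =>
        rw [cl_mul_cl, K0.lift_cl, K0.lift_cl, K0.lift_cl, cl_mul_cl]
        rfl

theorem cl_ofChar_one : cl (FinRep.ofChar (1 : G →* kˣ)) = 1 := by
  have h : FinRep.ofChar (1 : G →* kˣ) = FinRep.one k G := by
    unfold FinRep.ofChar FinRep.one
    congr 1
    ext g
    simp
  rw [h, K0.one_def]

theorem cl_ofChar_mul (χ ψ : G →* kˣ) :
    cl (FinRep.ofChar χ) * cl (FinRep.ofChar ψ) = cl (FinRep.ofChar (χ * ψ)) := by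
  rw [cl_mul_cl]
  refine cl_eq_of_equiv (A := (FinRep.ofChar χ).tensor (FinRep.ofChar ψ))
    (B := FinRep.ofChar (χ * ψ)) (Representation.Equiv.mk (TensorProduct.lid k k) fun g => ?_)
  refine TensorProduct.ext' fun (x : k) (y : k) => ?_
  change ((χ g : k) * x) * ((ψ g : k) * y) = ((χ * ψ) g : k) * (x * y)
  simp only [MonoidHom.mul_apply, Units.val_mul]
  ring

/-- The class of a character, as a unit of `K0`. -/
def charUnit (χ : G →* kˣ) : (K0 k G)ˣ where
  val := cl (FinRep.ofChar χ)
  inv := cl (FinRep.ofChar χ⁻¹)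
  val_inv := by rw [cl_ofChar_mul, mul_inv_cancel χ, cl_ofChar_one]
  inv_val := by rw [cl_ofChar_mul, inv_mul_cancel χ, cl_ofChar_one]

end General

/-! ## Symmetric powers, the determinant and Frobenius twists for `GL₂` -/

section GL2

variable (K : Type u) [Field K]

/-- The action of `GL₂(K)` on `K[X₀, X₁]` by algebra automorphisms, `g • X_j = ∑ i, g_{ij} X_i`. -/
def polyAction : Representation K (GL (Fin 2) K) (MvPolynomial (Fin 2) K) where
  toFun g := (MvPolynomial.aeval fun j : Fin 2 =>
    ∑ i : Fin 2, MvPolynomial.C (g i j) * MvPolynomial.X i).toLinearMap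
  map_one' := by
    have h : (MvPolynomial.aeval fun j : Fin 2 =>
        ∑ i : Fin 2, MvPolynomial.C ((1 : GL (Fin 2) K) i j) * MvPolynomial.X i) =
        AlgHom.id K (MvPolynomial (Fin 2) K) := by
      apply MvPolynomial.algHom_ext
      intro j
      fin_cases j <;> simp [Fin.sum_univ_two]
    rw [h]
    rfl
  map_mul' g h := by
    have hgh : (MvPolynomial.aeval fun j : Fin 2 =>
        ∑ i : Fin 2, MvPolynomial.C ((g * h) i j) * MvPolynomial.X i) =
        (MvPolynomial.aeval fun j : Fin 2 =>
          ∑ i : Fin 2, MvPolynomial.C (g i j) * MvPolynomial.X i).comp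
        ((MvPolynomial.aeval fun j : Fin 2 =>
          ∑ i : Fin 2, MvPolynomial.C (h i j) * MvPolynomial.X i) :
            MvPolynomial (Fin 2) K →ₐ[K] MvPolynomial (Fin 2) K) := by
      apply MvPolynomial.algHom_ext
      intro j
      simp [Fin.sum_univ_two, Matrix.mul_apply, MvPolynomial.algHom_C]
      ring
    rw [hgh]
    rfl

theorem polyAction_mem (n : ℕ) (g : GL (Fin 2) K) :
    MvPolynomial.homogeneousSubmodule (Fin 2) K n ≤
      (MvPolynomial.homogeneousSubmodule (Fin 2) K n).comap (polyAction K g) := by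
  intro f hf
  rw [MvPolynomial.mem_homogeneousSubmodule] at hf
  have h := hf.aeval (n := 1) (fun j : Fin 2 =>
    ∑ i : Fin 2, MvPolynomial.C (g i j) * (MvPolynomial.X i : MvPolynomial (Fin 2) K))
    (fun j => MvPolynomial.IsHomogeneous.sum _ _ _ fun i _ =>
      MvPolynomial.IsHomogeneous.C_mul (MvPolynomial.isHomogeneous_X K i) _)
  rw [one_mul] at h
  exact h

instance (n : ℕ) : Module.Finite K (MvPolynomial.homogeneousSubmodule (Fin 2) K n) :=
  Module.Finite.iff_fg.2 (MvPolynomial.homogeneousSubmodule_fg (Fin 2) K n)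

/-- The `n`-th symmetric power of the standard representation, realised on the homogeneous
polynomials of degree `n` in two variables. -/
def symRep (n : ℕ) : FinRep K (GL (Fin 2) K) :=
  ⟨MvPolynomial.homogeneousSubmodule (Fin 2) K n,
    (polyAction K).subrepresentation _ (polyAction_mem K n)⟩

/-- The class `e` of the determinant character, a unit of the Grothendieck ring. -/
def e : (K0 K (GL (Fin 2) K))ˣ := charUnit Matrix.GeneralLinearGroup.det

/-- The classes `M_k` for all integers `k`: `M_k = [Sym^k]` for `k ≥ 0`, `M_{-1} = 0` and
`M_k = - e^{1+k} M_{-k-2}` for `k ≤ -2`. -/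
def M (k : ℤ) : K0 K (GL (Fin 2) K) :=
  if 0 ≤ k then cl (symRep K k.toNat)
  else if k = -1 then 0
  else -(((e K) ^ (1 + k) : (K0 K (GL (Fin 2) K))ˣ) : K0 K (GL (Fin 2) K)) *
    cl (symRep K (-k - 2).toNat)

variable (p : ℕ) [Fact p.Prime] [CharP K p] [Finite K]

/-- The automorphism of `GL₂(K)` which applies `σ ^ i` to the entries, where `σ : x ↦ x ^ p`. -/
def frobGL (i : ℤ) : GL (Fin 2) K →* GL (Fin 2) K :=
  Matrix.GeneralLinearGroup.map ((frobeniusEquiv K p ^ i : K ≃+* K) : K →+* K)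

/-- The `i`-th Frobenius twist `x ↦ x^{[i]}` on the Grothendieck ring. -/
def twist (i : ℤ) : K0 K (GL (Fin 2) K) →+* K0 K (GL (Fin 2) K) :=
  K0.res (frobGL K p i)

end GL2

end ModularRep

end

/-! The identity combines two linear relations among the `M_k`. For `q = p ^ j`, the forms `X₀ ^ q,
X₁ ^ q` have no common factor, so their Koszul complex on binary forms is exact in degrees at least
`2q`. Because `(x + y) ^ q = x ^ q + y ^ q`, they span a copy of the standard representation with
matrix entries raised to the power `q`. This gives an equivariant exact sequence `0 → det^q ⊗ Sym^n
→ Sym^{n+q} ⊗ (Sym^1)^{[j]} → Sym^{n+2q} → 0`, whose class is `cl_symRep_mul_res`.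

Taking `q = 1` gives `M_{k+1} + e M_{k-1} = M_1 M_k` (`M_add_one`), which the reflection `M_k =
-e^{1+k} M_{-k-2}` carries to negative `k`. Taking `q = p` gives `M_k - M_1^{[1]} M_{k-p} + e^p
M_{k-2p} = 0` for `k ≥ 2p`. As a function of `k`, its left side obeys the first recurrence, in which
`e` is a unit, so it vanishes for every integer `k` (`M_frobenius_relation`).

Twist the second relation by `[i]` and multiply by `M_h^{[i+1]}`; twist the first, at `h`, by
`[i+1]` and multiply by `M_{k-p}^{[i]}`. Both contain `M_1^{[i+1]} M_{k-p}^{[i]} M_h^{[i+1]}`, and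
eliminating it leaves the claim. -/

noncomputable section

universe u v

namespace ModularRep

/-! ### Exactness of the Koszul complex of `X₀ ^ q, X₁ ^ q` on binary forms. -/

section Koszul

open MvPolynomial

variable {K : Type u} [Field K]

/-- Multiplication of homogeneous polynomials. -/
def homogMul (m n : ℕ) : homogeneousSubmodule (Fin 2) K m →ₗ[K]
    homogeneousSubmodule (Fin 2) K n →ₗ[K] homogeneousSubmodule (Fin 2) K (m + n) :=
  LinearMap.mk₂ K (fun a b => ⟨a.1 * b.1, a.2.mul b.2⟩)
    (fun _ _ _ => Subtype.ext (add_mul _ _ _)) (fun _ _ _ => Subtype.ext (smul_mul_assoc _ _ _))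
    (fun _ _ _ => Subtype.ext (mul_add _ _ _)) (fun _ _ _ => Subtype.ext (mul_smul_comm _ _ _))

@[simp]
theorem coe_homogMul {m n : ℕ} (a : homogeneousSubmodule (Fin 2) K m)
    (b : homogeneousSubmodule (Fin 2) K n) : (homogMul m n a b : MvPolynomial (Fin 2) K) = a * b :=
  rfl

/-- The power `X_j ^ q` as a homogeneous polynomial of degree `q`. -/
def powX (q : ℕ) (j : Fin 2) : homogeneousSubmodule (Fin 2) K q :=
  ⟨X j ^ q, isHomogeneous_X_pow j q⟩

/-- The variable `X_j` as a homogeneous polynomial of degree `1`. -/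
def linX (j : Fin 2) : homogeneousSubmodule (Fin 2) K 1 := ⟨X j, isHomogeneous_X K j⟩

/-- The linear map `X_j ↦ X_j ^ q` on linear forms. -/
def expandLin (q : ℕ) : homogeneousSubmodule (Fin 2) K 1 →ₗ[K] homogeneousSubmodule (Fin 2) K q :=
  (expand q).toLinearMap.restrict fun f hf => by
    have h := IsHomogeneous.aeval hf (fun j : Fin 2 => (X j ^ q : MvPolynomial (Fin 2) K))
      (fun j => isHomogeneous_X_pow j q)
    rw [mul_one] at h
    exact h

@[simp]
theorem expandLin_linX (q : ℕ) (j : Fin 2) : expandLin q (linX j) = powX (K := K) q j :=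
  Subtype.ext (expand_X q j)

theorem exists_eq_linX (w : homogeneousSubmodule (Fin 2) K 1) :
    ∃ a b : K, w = a • linX 0 + b • linX 1 := by
  have hw : (w : MvPolynomial (Fin 2) K) ∈ Submodule.span K (Set.range X) := by
    rw [← homogeneousSubmodule_one_eq_span_X]
    exact w.2
  obtain ⟨c, hc⟩ := (Submodule.mem_span_range_iff_exists_fun K).1 hw
  refine ⟨c 0, c 1, Subtype.ext ?_⟩
  rw [← hc, Fin.sum_univ_two]
  rfl

/-- Reduces exactness at the middle term to a statement about pairs of forms `(a, b)`. -/
theorem exists_tmul_linX {m : ℕ} (t : homogeneousSubmodule (Fin 2) K m ⊗[K]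
    homogeneousSubmodule (Fin 2) K 1) : ∃ a b, t = a ⊗ₜ[K] linX 0 + b ⊗ₜ[K] linX 1 := by
  induction t with
  | zero => exact ⟨0, 0, by simp⟩
  | tmul f w =>
    obtain ⟨a, b, rfl⟩ := exists_eq_linX w
    exact ⟨a • f, b • f, by simp [TensorProduct.tmul_add, TensorProduct.smul_tmul]⟩
  | add s t hs ht =>
    obtain ⟨a, b, rfl⟩ := hs
    obtain ⟨c, d, rfl⟩ := ht
    exact ⟨a + c, b + d, by simp only [TensorProduct.add_tmul]; abel⟩

theorem degree_of_coeff_ne_zero {n : ℕ} {f : MvPolynomial (Fin 2) K} (hf : f.IsHomogeneous n)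
    {d : Fin 2 →₀ ℕ} (hd : coeff d f ≠ 0) : d.degree = n :=
  by_contra fun h => hd (hf.coeff_eq_zero h)

theorem isHomogeneous_of_X_pow_mul {q n : ℕ} {j : Fin 2} {c : MvPolynomial (Fin 2) K}
    (h : (X j ^ q * c).IsHomogeneous (n + q)) : c.IsHomogeneous n := by
  intro d hd
  have hd' : coeff (Finsupp.single j q + d) (X j ^ q * c) ≠ 0 := by
    rwa [X_pow_eq_monomial, coeff_monomial_mul, one_mul]
  have := degree_of_coeff_ne_zero h hd'
  change Finsupp.weight (fun _ => 1) d = n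
  rw [← Finsupp.degree_eq_weight_one]
  rw [map_add, Finsupp.degree_single] at this
  omega

/-- The syzygies of `X₀ ^ q, X₁ ^ q` among homogeneous polynomials. -/
theorem exists_of_mul_add_mul_eq_zero {n q : ℕ} (a b : homogeneousSubmodule (Fin 2) K (n + q))
    (h : homogMul (n + q) q a (powX q 0) + homogMul (n + q) q b (powX q 1) = 0) :
    ∃ c, a = homogMul n q c (powX q 1) ∧ b = -homogMul n q c (powX q 0) := by
  have h' : (a : MvPolynomial (Fin 2) K) * X 0 ^ q + b.1 * X 1 ^ q = 0 := congrArg Subtype.val h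
  -- `X 0` is prime and does not divide `X 1 ^ q`, so the relation forces `X 0 ^ q` into `b`. The
  -- required syzygy is minus the quotient.
  have hdvd : (X 0 : MvPolynomial (Fin 2) K) ^ q ∣ b := by
    refine (X_prime (R := K) (i := (0 : Fin 2))).pow_dvd_of_dvd_mul_right q
      (b := X 1 ^ q) ?_ ⟨-a, by linear_combination h'⟩
    intro hX
    have := (X_prime (R := K) (i := (0 : Fin 2))).dvd_of_dvd_pow hX
    rw [X_dvd_X] at this
    simp at this
  obtain ⟨c, hc⟩ := hdvd
  have hch : c.IsHomogeneous n := isHomogeneous_of_X_pow_mul (hc ▸ b.2)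
  refine ⟨⟨-c, hch.neg⟩, Subtype.ext ?_, Subtype.ext ?_⟩
  · refine mul_right_cancel₀ (pow_ne_zero q (X_ne_zero (R := K) (0 : Fin 2))) ?_
    change (a : MvPolynomial (Fin 2) K) * X 0 ^ q = -c * X 1 ^ q * X 0 ^ q
    rw [hc] at h'
    linear_combination h'
  · change (b : MvPolynomial (Fin 2) K) = -(-c * X 0 ^ q)
    rw [hc]
    ring

/-- Pigeonhole: a monomial of degree at least `2q` in two variables has an exponent at least `q`. -/
theorem exists_mul_add_mul_eq {n q : ℕ} (f : homogeneousSubmodule (Fin 2) K (n + q + q)) :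
    ∃ a b, f = homogMul (n + q) q a (powX q 0) + homogMul (n + q) q b (powX q 1) := by
  set φ : Fin 2 → homogeneousSubmodule (Fin 2) K (n + q) →ₗ[K] MvPolynomial (Fin 2) K :=
    fun j => (homogeneousSubmodule (Fin 2) K (n + q + q)).subtype ∘ₗ
      (homogMul (n + q) q).flip (powX q j) with hφ
  have key : ∀ (d : Fin 2 →₀ ℕ) (r : K) (j : Fin 2), d.degree = n + q + q → q ≤ d j →
      monomial d r ∈ LinearMap.range (φ j) := by
    intro d r j hd hj
    have hle : Finsupp.single j q ≤ d := Finsupp.single_le_iff.2 hj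
    obtain ⟨d', rfl⟩ := exists_add_of_le hle
    rw [map_add, Finsupp.degree_single] at hd
    refine ⟨⟨monomial d' r, isHomogeneous_monomial r (by omega)⟩, ?_⟩
    change monomial d' r * X j ^ q = _
    rw [X_pow_eq_monomial, monomial_mul, mul_one, add_comm]
  have hf : (f : MvPolynomial (Fin 2) K) ∈ LinearMap.range (φ 0) ⊔ LinearMap.range (φ 1) := by
    rw [(f : MvPolynomial (Fin 2) K).as_sum]
    refine Submodule.sum_mem _ fun d hd => ?_
    have hdeg := degree_of_coeff_ne_zero f.2 (mem_support_iff.1 hd)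
    have hsum : d 0 + d 1 = n + q + q := by
      rw [← hdeg, Finsupp.degree_eq_sum, Fin.sum_univ_two]
    rcases le_or_gt q (d 0) with h | h
    · exact Submodule.mem_sup_left (key d _ 0 hdeg h)
    · exact Submodule.mem_sup_right (key d _ 1 hdeg (by omega))
  obtain ⟨_, ⟨a, rfl⟩, _, ⟨b, rfl⟩, hab⟩ := Submodule.mem_sup.1 hf
  exact ⟨a, b, Subtype.ext hab.symm⟩

/-- The first map of the Koszul complex of `X₀ ^ q, X₁ ^ q`. -/
def koszulFst (n q : ℕ) : homogeneousSubmodule (Fin 2) K n →ₗ[K]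
    homogeneousSubmodule (Fin 2) K (n + q) ⊗[K] homogeneousSubmodule (Fin 2) K 1 :=
  (TensorProduct.mk K (homogeneousSubmodule (Fin 2) K (n + q))
    (homogeneousSubmodule (Fin 2) K 1)).flip (linX 0) ∘ₗ (homogMul n q).flip (powX q 1) +
    (TensorProduct.mk K (homogeneousSubmodule (Fin 2) K (n + q))
    (homogeneousSubmodule (Fin 2) K 1)).flip (-linX 1) ∘ₗ (homogMul n q).flip (powX q 0)

theorem koszulFst_apply (n q : ℕ) (f : homogeneousSubmodule (Fin 2) K n) :
    koszulFst n q f = homogMul n q f (powX q 1) ⊗ₜ linX 0 -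
      homogMul n q f (powX q 0) ⊗ₜ linX 1 := by
  rw [sub_eq_add_neg, ← TensorProduct.tmul_neg]
  rfl

/-- The second map of the Koszul complex of `X₀ ^ q, X₁ ^ q`. -/
def koszulSnd (m q : ℕ) : homogeneousSubmodule (Fin 2) K m ⊗[K]
    homogeneousSubmodule (Fin 2) K 1 →ₗ[K] homogeneousSubmodule (Fin 2) K (m + q) :=
  TensorProduct.lift ((homogMul m q).compl₂ (expandLin q))

@[simp]
theorem koszulSnd_tmul (m q : ℕ) (f : homogeneousSubmodule (Fin 2) K m)
    (w : homogeneousSubmodule (Fin 2) K 1) :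
    koszulSnd m q (f ⊗ₜ w) = homogMul m q f (expandLin q w) := by
  simp [koszulSnd]

theorem koszulFst_injective (n q : ℕ) : Function.Injective (koszulFst (K := K) n q) := by
  rw [injective_iff_map_eq_zero]
  intro f hf
  -- The projection of linear forms that kills `X 1` and fixes `X 0`, followed by multiplication,
  -- sends the image of `f` to `f * X 1 ^ q * X 0`.
  have h := congrArg (TensorProduct.lift ((homogMul (K := K) (n + q) 1).compl₂
    (LinearMap.id - (lcoeff K (Finsupp.single 1 1) ∘ₗ
      (homogeneousSubmodule (Fin 2) K 1).subtype).smulRight (linX 1)))) hf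
  rw [koszulFst_apply] at h
  have h0 : coeff (Finsupp.single 1 1) (X 0 : MvPolynomial (Fin 2) K) = 0 := by
    rw [coeff_X, if_neg]
    intro h
    simpa using DFunLike.congr_fun h 0
  have h1 : coeff (Finsupp.single 1 1) (X 1 : MvPolynomial (Fin 2) K) = 1 := by
    simp [coeff_X]
  simp [linX, h0, h1, powX] at h
  have h' := congrArg Subtype.val h
  simpa using h'

theorem koszulSnd_surjective (n q : ℕ) : Function.Surjective (koszulSnd (K := K) (n + q) q) := by
  intro f
  obtain ⟨a, b, rfl⟩ := exists_mul_add_mul_eq f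
  exact ⟨a ⊗ₜ linX 0 + b ⊗ₜ linX 1, by simp⟩

theorem koszul_exact (n q : ℕ) :
    Function.Exact (koszulFst (K := K) n q) (koszulSnd (n + q) q) := by
  intro t
  constructor
  · intro ht
    obtain ⟨a, b, rfl⟩ := exists_tmul_linX t
    simp only [map_add, koszulSnd_tmul, expandLin_linX] at ht
    obtain ⟨c, rfl, rfl⟩ := exists_of_mul_add_mul_eq_zero a b ht
    exact ⟨c, by rw [koszulFst_apply, TensorProduct.neg_tmul, sub_eq_add_neg]⟩
  · rintro ⟨f, rfl⟩
    rw [koszulFst_apply]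
    simp only [map_sub, koszulSnd_tmul, expandLin_linX]
    refine Subtype.ext ?_
    change (f : MvPolynomial (Fin 2) K) * X 1 ^ q * X 0 ^ q - f.1 * X 0 ^ q * X 1 ^ q = 0
    ring

/-! ### Equivariance of the Koszul complex and the resulting relation in `K0`. -/

/-- The action of `GL₂` on homogeneous polynomials of degree `n`. -/
def homogAct (n : ℕ) (g : GL (Fin 2) K) : Module.End K (homogeneousSubmodule (Fin 2) K n) :=
  (symRep K n).ρ g

theorem coe_homogAct (n : ℕ) (g : GL (Fin 2) K) (f : homogeneousSubmodule (Fin 2) K n) :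
    (homogAct n g f : MvPolynomial (Fin 2) K) =
      aeval (fun j : Fin 2 => ∑ i : Fin 2, C (g i j) * X i) (f : MvPolynomial (Fin 2) K) := rfl

theorem homogAct_homogMul (m n : ℕ) (g : GL (Fin 2) K) (a : homogeneousSubmodule (Fin 2) K m)
    (b : homogeneousSubmodule (Fin 2) K n) :
    homogAct (m + n) g (homogMul m n a b) = homogMul m n (homogAct m g a) (homogAct n g b) :=
  Subtype.ext (map_mul (aeval fun j : Fin 2 => ∑ i : Fin 2, C (g i j) * X i) a.1 b.1)

theorem homogAct_linX (g : GL (Fin 2) K) (j : Fin 2) :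
    homogAct 1 g (linX j) = g 0 j • linX 0 + g 1 j • linX (K := K) 1 := by
  refine Subtype.ext ?_
  change _ = g 0 j • (X 0 : MvPolynomial (Fin 2) K) + g 1 j • X 1
  rw [coe_homogAct]
  simp [linX, Fin.sum_univ_two, smul_eq_C_mul]

theorem homogAct_powX (p : ℕ) [ExpChar K p] (j : ℕ) (g : GL (Fin 2) K) (i : Fin 2) :
    homogAct (p ^ j) g (powX (p ^ j) i) =
      (g 0 i) ^ p ^ j • powX (p ^ j) 0 + (g 1 i) ^ p ^ j • powX (K := K) (p ^ j) 1 := by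
  refine Subtype.ext ?_
  change _ = (g 0 i) ^ p ^ j • (X 0 ^ p ^ j : MvPolynomial (Fin 2) K) +
    (g 1 i) ^ p ^ j • X 1 ^ p ^ j
  rw [coe_homogAct]
  simp [powX, Fin.sum_univ_two, smul_eq_C_mul, add_pow_expChar_pow, mul_pow]

/-- Additivity of the `p ^ j`-th power makes `X_i ↦ X_i ^ (p ^ j)` equivariant, provided the source
is twisted by `φ`. -/
theorem homogAct_expandLin (p : ℕ) [ExpChar K p] (j : ℕ) {φ : GL (Fin 2) K →* GL (Fin 2) K}
    (hφ : ∀ g a b, φ g a b = (g a b) ^ p ^ j) (g : GL (Fin 2) K)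
    (w : homogeneousSubmodule (Fin 2) K 1) :
    expandLin (p ^ j) (homogAct 1 (φ g) w) = homogAct (p ^ j) g (expandLin (p ^ j) w) := by
  obtain ⟨a, b, rfl⟩ := exists_eq_linX w
  simp only [map_add, map_smul, homogAct_linX, expandLin_linX, homogAct_powX, hφ]

/-- Expanding the right side, the terms in `X₀ ^ q ⊗ X₀` and `X₁ ^ q ⊗ X₁` cancel, where `q = p ^
j`, and the mixed terms acquire the determinant of `φ g`. -/
theorem koszulFst_equivariant (p : ℕ) [ExpChar K p] (j n : ℕ) {φ : GL (Fin 2) K →* GL (Fin 2) K}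
    (hφ : ∀ g a b, φ g a b = (g a b) ^ p ^ j) (g : GL (Fin 2) K)
    (f : homogeneousSubmodule (Fin 2) K n) :
    koszulFst n (p ^ j) (((Matrix.GeneralLinearGroup.det (φ g) : Kˣ) : K) • homogAct n g f) =
      TensorProduct.map (homogAct (n + p ^ j) g) (homogAct 1 (φ g)) (koszulFst n (p ^ j) f) := by
  have hdet : ((Matrix.GeneralLinearGroup.det (φ g) : Kˣ) : K) =
      (g 0 0) ^ p ^ j * (g 1 1) ^ p ^ j - (g 0 1) ^ p ^ j * (g 1 0) ^ p ^ j := by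
    rw [← hφ, ← hφ, ← hφ, ← hφ]
    exact Matrix.det_fin_two _
  rw [hdet, map_smul, koszulFst_apply, koszulFst_apply, map_sub]
  simp only [TensorProduct.map_tmul, homogAct_homogMul, homogAct_powX, homogAct_linX, hφ, map_add,
    map_smul, TensorProduct.add_tmul, TensorProduct.tmul_add, TensorProduct.tmul_smul,
    ← TensorProduct.smul_tmul']
  module

theorem koszulSnd_equivariant (p : ℕ) [ExpChar K p] (j m : ℕ) {φ : GL (Fin 2) K →* GL (Fin 2) K}
    (hφ : ∀ g a b, φ g a b = (g a b) ^ p ^ j) (g : GL (Fin 2) K) :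
    koszulSnd m (p ^ j) ∘ₗ TensorProduct.map (homogAct m g) (homogAct 1 (φ g)) =
      homogAct (m + p ^ j) g ∘ₗ koszulSnd m (p ^ j) := by
  refine TensorProduct.ext' fun f w => ?_
  simp only [LinearMap.comp_apply, TensorProduct.map_tmul, koszulSnd_tmul, homogAct_homogMul,
    homogAct_expandLin p j hφ]

/-- The Koszul relation in the Grothendieck ring. -/
theorem cl_symRep_mul_res (p : ℕ) [ExpChar K p] (j n : ℕ) {φ : GL (Fin 2) K →* GL (Fin 2) K}
    (hφ : ∀ g a b, φ g a b = (g a b) ^ p ^ j) :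
    cl (symRep K (n + p ^ j)) * K0.res φ (cl (symRep K 1)) =
      K0.res φ (e K : K0 K (GL (Fin 2) K)) * cl (symRep K n) +
        cl (symRep K (n + p ^ j + p ^ j)) := by
  have h1 : K0.res φ (cl (symRep K 1)) = cl ((symRep K 1).res φ) :=
    K0.lift_cl _ (fun _ _ _ h => cl_of_isExtension (h.res φ)) _
  have h2 : K0.res φ (e K : K0 K (GL (Fin 2) K)) =
    cl ((FinRep.ofChar Matrix.GeneralLinearGroup.det).res φ) :=
    K0.lift_cl _ (fun _ _ _ h => cl_of_isExtension (h.res φ)) _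
  rw [h1, h2, cl_mul_cl, cl_mul_cl]
  -- The determinant twist of `Sym^n` lives on `K ⊗ Sym^n`; `TensorProduct.lid` identifies this
  -- space with `Sym^n`.
  refine cl_of_isExtension ⟨⟨koszulFst n (p ^ j) ∘ₗ
    (TensorProduct.lid K (homogeneousSubmodule (Fin 2) K n)).toLinearMap, fun g => ?_⟩,
    ⟨koszulSnd (n + p ^ j) (p ^ j), fun g => ?_⟩, ?_, ?_, koszulSnd_surjective n (p ^ j)⟩
  · refine TensorProduct.ext' fun (x : K) (f : homogeneousSubmodule (Fin 2) K n) => ?_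
    refine Eq.trans (congrArg (koszulFst n (p ^ j)) (?_ : _ =
      (((Matrix.GeneralLinearGroup.det (φ g) : Kˣ) : K) • homogAct n g (x • f :
        homogeneousSubmodule (Fin 2) K n) : homogeneousSubmodule (Fin 2) K n)))
      (koszulFst_equivariant p j n hφ g (x • f))
    refine (TensorProduct.lid_tmul _ _).trans ?_
    refine Eq.trans ?_ (congrArg (HSMul.hSMul _) (map_smul (homogAct n g) x f).symm)
    exact mul_smul _ _ _
  · exact koszulSnd_equivariant p j _ hφ g
  · exact (koszulFst_injective n (p ^ j)).comp (TensorProduct.lid K _).injective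
  · have h : Function.Exact (koszulFst n (p ^ j) ∘ₗ
        (TensorProduct.lid K (homogeneousSubmodule (Fin 2) K n)).toLinearMap)
        (koszulSnd (n + p ^ j) (p ^ j)) := fun t => by
      rw [koszul_exact n (p ^ j) t, LinearMap.coe_comp, LinearEquiv.coe_coe, EquivLike.range_comp]
    exact h

theorem cl_symRep_zero : cl (symRep K 0) = 1 := by
  rw [K0.one_def]
  refine (cl_eq_of_equiv (A := FinRep.one K _) (B := symRep K 0) (Representation.Equiv.mk
    (LinearEquiv.ofBijective ((LinearMap.toSpanSingleton K (homogeneousSubmodule (Fin 2) K 0)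
      ⟨1, isHomogeneous_one _ _⟩)) ⟨?_, ?_⟩) fun g => ?_)).symm
  · intro a b hab
    have h := congrArg (fun f : homogeneousSubmodule (Fin 2) K 0 => constantCoeff f.1) hab
    simpa using h
  · rintro ⟨f, hf⟩
    rw [homogeneousSubmodule_zero, Submodule.mem_one] at hf
    obtain ⟨a, rfl⟩ := hf
    exact ⟨a, Subtype.ext (Algebra.algebraMap_eq_smul_one (A := MvPolynomial (Fin 2) K) a).symm⟩
  · refine LinearMap.ext fun (a : K) => Subtype.ext ?_
    change a • (1 : MvPolynomial (Fin 2) K) =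
      aeval (fun j : Fin 2 => ∑ i : Fin 2, C (g i j) * X i) (a • (1 : MvPolynomial (Fin 2) K))
    rw [map_smul, map_one]

end Koszul

/-! ### Recurrences for `M_k` over all integers `k`. -/

section Recurrence

variable (K : Type u) [Field K]

theorem M_natCast (n : ℕ) : M K n = cl (symRep K n) := by
  rw [M, if_pos (Int.natCast_nonneg n), Int.toNat_natCast]

theorem M_neg_one : M K (-1) = 0 := by
  rw [M, if_neg (by norm_num), if_pos rfl]

theorem M_zero : M K 0 = 1 := by
  rw [← Nat.cast_zero, M_natCast, cl_symRep_zero]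

/-- The reflection `M_k = - e^{1+k} M_{-k-2}`, for all integers `k`. -/
theorem M_reflect (k : ℤ) :
    M K k = -((e K ^ (1 + k) : (K0 K (GL (Fin 2) K))ˣ) : K0 K (GL (Fin 2) K)) * M K (-k - 2) := by
  have key (n : ℕ) : M K (-n - 2) =
      -((e K ^ (1 + (-n - 2 : ℤ)) : (K0 K (GL (Fin 2) K))ˣ) : K0 K (GL (Fin 2) K)) * M K n := by
    rw [M_natCast, M, if_neg (by omega), if_neg (by omega),
      show (-(-(n : ℤ) - 2) - 2).toNat = n by omega]
  rcases lt_trichotomy k (-1) with hk | rfl | hk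
  · obtain ⟨n, hn⟩ := Int.eq_ofNat_of_zero_le (show 0 ≤ -k - 2 by omega)
    have h := key n
    rwa [← hn, show -(-k - 2) - 2 = k by ring] at h
  · norm_num [M_neg_one]
  -- The reflection is an involution: the exponents `1 + k` and `-1 - k` cancel.
  · obtain ⟨n, rfl⟩ := Int.eq_ofNat_of_zero_le (show 0 ≤ k by omega)
    rw [key n, ← mul_assoc, neg_mul_neg, ← Units.val_mul, ← zpow_add,
      show (1 + (n : ℤ) + (1 + (-n - 2))) = 0 by ring, zpow_zero, Units.val_one, one_mul]

theorem M_add_one_of_nonneg (n : ℕ) :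
    M K (n + 1) + e K * M K (n - 1) = M K 1 * M K n := by
  rcases n with _ | n
  · simp [M_zero, M_neg_one]
  · obtain ⟨q, _⟩ := ExpChar.exists K
    -- With `j = 0` the power is `q ^ 0 = 1` and no twist occurs, so any exponential characteristic
    -- `q` serves.
    have h := cl_symRep_mul_res (K := K) q 0 n (φ := MonoidHom.id _) (by simp)
    have hid (A : FinRep K (GL (Fin 2) K)) : K0.res (MonoidHom.id _) (cl A) = cl A :=
      K0.lift_cl _ (fun _ _ _ h => cl_of_isExtension (h.res (MonoidHom.id _))) _
    have he : K0.res (MonoidHom.id _) (e K : K0 K (GL (Fin 2) K)) = e K := hid _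
    rw [he, hid, pow_zero, ← M_natCast, ← M_natCast, ← M_natCast, ← M_natCast] at h
    push_cast at h ⊢
    rw [add_sub_cancel_right, mul_comm (M K 1), h, add_comm]

/-- The recurrence `M_{k+1} + e M_{k-1} = M_1 M_k`, for all integers `k`. -/
theorem M_add_one (k : ℤ) : M K (k + 1) + e K * M K (k - 1) = M K 1 * M K k := by
  rcases lt_trichotomy k (-1) with hk | rfl | hk
  -- Reflection swaps the two outer terms: the relation at `k = -n - 2` is `-e^{k+1}` times the one
  -- at `n`.
  · obtain ⟨n, hn⟩ := Int.eq_ofNat_of_zero_le (show 0 ≤ -k - 2 by omega)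
    obtain rfl : k = -n - 2 := by omega
    have h := M_add_one_of_nonneg K n
    rw [M_reflect K (-n - 2 + 1), M_reflect K (-n - 2 - 1), M_reflect K (-n - 2),
      show -(-(n : ℤ) - 2 + 1) - 2 = n - 1 by ring, show -(-(n : ℤ) - 2 - 1) - 2 = n + 1 by ring,
      show -(-(n : ℤ) - 2) - 2 = n by ring,
      show 1 + (-(n : ℤ) - 2 + 1) = 1 + (-n - 2 - 1) + 2 by ring,
      show 1 + (-(n : ℤ) - 2) = 1 + (-n - 2 - 1) + 1 by ring, zpow_add, zpow_add _ _ 1]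
    push_cast
    simp only [zpow_ofNat, Units.val_pow_eq_pow_val]
    linear_combination -(((e K ^ (1 + (-(n : ℤ) - 2 - 1)) : (K0 K (GL (Fin 2) K))ˣ) :
      K0 K (GL (Fin 2) K)) * e K) * h
  · have h := M_reflect K (-1 - 1)
    norm_num [M_zero] at h
    norm_num [M_zero, M_neg_one, h]
  · obtain ⟨n, rfl⟩ := Int.eq_ofNat_of_zero_le (show 0 ≤ k by omega)
    exact M_add_one_of_nonneg K n

/-- A sequence with a recurrence `u_{k+1} + ε u_{k-1} = t u_k`, for a unit `ε`, vanishes if two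
consecutive terms do. -/
theorem eq_zero_of_recurrence {R : Type*} [CommRing R] (ε : Rˣ) (t : R) (u : ℤ → R)
    (hu : ∀ k, u (k + 1) + ε * u (k - 1) = t * u k) (b : ℤ) (h0 : u b = 0) (h1 : u (b + 1) = 0)
    (k : ℤ) : u k = 0 := by
  suffices h : u k = 0 ∧ u (k + 1) = 0 from h.1
  induction k using Int.inductionOn' (b := b) with
  | zero => exact ⟨h0, h1⟩
  | succ k _ ih =>
    refine ⟨ih.2, ?_⟩
    have h := hu (k + 1)
    rw [add_sub_cancel_right, ih.1, ih.2] at h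
    simpa using h
  | pred k _ ih =>
    rw [sub_add_cancel]
    refine ⟨?_, ih.1⟩
    have h := hu k
    rw [ih.1, ih.2] at h
    simpa using h

theorem cl_ofChar_pow {G : Type v} [Monoid G] (χ : G →* Kˣ) (n : ℕ) :
    cl (FinRep.ofChar χ) ^ n = cl (FinRep.ofChar (χ ^ n)) := by
  induction n with
  | zero => rw [pow_zero, pow_zero χ, cl_ofChar_one]
  | succ n ih => rw [pow_succ, ih, cl_ofChar_mul, pow_succ χ]

/-! ### Frobenius twists and the relation with step `p`. -/

variable (p : ℕ) [Fact p.Prime] [CharP K p] [Finite K]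

theorem twist_eq_cl (i : ℤ) (A : FinRep K (GL (Fin 2) K)) :
    twist K p i (cl A) = cl (A.res (frobGL K p i)) :=
  K0.lift_cl _ (fun _ _ _ h => cl_of_isExtension (h.res (frobGL K p i))) _

theorem frobGL_add (i j : ℤ) : frobGL K p (i + j) = (frobGL K p j).comp (frobGL K p i) := by
  ext g a b
  change (frobeniusEquiv K p ^ (i + j)) (g a b) =
    (frobeniusEquiv K p ^ j) ((frobeniusEquiv K p ^ i) (g a b))
  rw [add_comm, zpow_add]
  rfl

theorem twist_add (i j : ℤ) (x : K0 K (GL (Fin 2) K)) :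
    twist K p (i + j) x = twist K p i (twist K p j x) := by
  induction x using K0.induction with
  | hcl A =>
    rw [twist_eq_cl, twist_eq_cl, twist_eq_cl, frobGL_add]
    rfl
  | hadd x y hx hy => simp only [map_add, hx, hy]
  | hneg x hx => simp only [map_neg, hx]

/-- The relation `M_k - M_1^{[1]} M_{k-p} + e^p M_{k-2p} = 0`, for all integers `k`. -/
theorem M_frobenius_relation (k : ℤ) :
    M K k - twist K p 1 (M K 1) * M K (k - p) +
      twist K p 1 (e K : K0 K (GL (Fin 2) K)) * M K (k - 2 * p) = 0 := by
  -- For `k ≥ 2p` all three indices are nonnegative and this is the Koszul relation with `j = 1`.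
  have key (n : ℕ) : M K (2 * p + n) - twist K p 1 (M K 1) * M K (2 * p + n - p) +
      twist K p 1 (e K : K0 K (GL (Fin 2) K)) * M K (2 * p + n - 2 * p) = 0 := by
    have := ExpChar.prime (R := K) (Fact.out : p.Prime)
    have h := cl_symRep_mul_res (K := K) p 1 n (φ := frobGL K p 1) (fun g a b => by
      change (frobeniusEquiv K p ^ (1 : ℤ)) (g a b) = _
      rw [zpow_one, frobeniusEquiv_def, pow_one])
    rw [pow_one, ← M_natCast, ← M_natCast, ← M_natCast, ← M_natCast] at h
    push_cast at h
    rw [show (2 * p + n - p : ℤ) = n + p by ring, show (2 * p + n : ℤ) = n + p + p by ring,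
      show (n + p + p - 2 * p : ℤ) = n by ring]
    change M K (n + p) * twist K p 1 (M K 1) =
      twist K p 1 (e K : K0 K (GL (Fin 2) K)) * M K n + M K (n + p + p) at h
    linear_combination -h
  -- The coefficients do not depend on `k`, so the left side inherits the recurrence of `M`; its
  -- zeros at `2p` and `2p + 1` propagate both ways.
  refine eq_zero_of_recurrence (e K) (M K 1)
    (fun k => M K k - twist K p 1 (M K 1) * M K (k - p) +
      twist K p 1 (e K : K0 K (GL (Fin 2) K)) * M K (k - 2 * p)) (fun k => ?_) (2 * p)
    (by simpa using key 0) (by simpa using key 1) k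
  have h0 := M_add_one K k
  have h1 := M_add_one K (k - p)
  have h2 := M_add_one K (k - 2 * p)
  simp only [show k + 1 - (p : ℤ) = k - p + 1 by ring, show k - 1 - (p : ℤ) = k - p - 1 by ring,
    show k + 1 - 2 * (p : ℤ) = k - 2 * p + 1 by ring,
    show k - 1 - 2 * (p : ℤ) = k - 2 * p - 1 by ring]
  linear_combination h0 - twist K p 1 (M K 1) * h1 +
    twist K p 1 (e K : K0 K (GL (Fin 2) K)) * h2

/-- `x ^ (p ^ g) = x` on `K`, so powers of Frobenius depend only on the exponent modulo `g`. -/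
theorem frobeniusEquiv_zpow_eq_pow {g : ℕ} (hK : Nat.card K = p ^ g) {j : ℤ} {m : ℕ}
    (hm : (m : ℤ) ≡ j [ZMOD (g : ℤ)]) (x : K) : (frobeniusEquiv K p ^ j) x = x ^ p ^ m := by
  have hpow (n : ℕ) (y : K) : (frobeniusEquiv K p ^ n) y = y ^ p ^ n := by
    rw [← iterateFrobeniusEquiv_eq_pow]
    rfl
  have hg : frobeniusEquiv K p ^ g = 1 := by
    ext y
    have := Fintype.ofFinite K
    rw [hpow, ← hK, Nat.card_eq_fintype_card, FiniteField.pow_card]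
    rfl
  obtain ⟨c, hc⟩ := hm.dvd
  rw [eq_add_of_sub_eq' hc, zpow_add, zpow_mul, zpow_natCast, zpow_natCast, hg, one_zpow, mul_one,
    hpow]

/-- The determinant commutes with field automorphisms, so twisting the character `det` by `σ ^ j`
raises it to the power `p ^ m`. -/
theorem twist_e {g : ℕ} (hK : Nat.card K = p ^ g) {j : ℤ} {m : ℕ}
    (hm : (m : ℤ) ≡ j [ZMOD (g : ℤ)]) :
    twist K p j (e K : K0 K (GL (Fin 2) K)) = (e K : K0 K (GL (Fin 2) K)) ^ p ^ m := by
  have he : (e K : K0 K (GL (Fin 2) K)) = cl (FinRep.ofChar Matrix.GeneralLinearGroup.det) := rfl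
  have hχ : Matrix.GeneralLinearGroup.det.comp (frobGL K p j) =
      (Matrix.GeneralLinearGroup.det : GL (Fin 2) K →* Kˣ) ^ p ^ m := by
    ext A
    have h := frobeniusEquiv_zpow_eq_pow K p hK hm
      (Matrix.det (A : Matrix (Fin 2) (Fin 2) K))
    rw [← RingEquiv.coe_toRingHom, RingHom.map_det] at h
    exact h
  rw [he, twist_eq_cl, cl_ofChar_pow, ← hχ]
  rfl

end Recurrence

end ModularRep

end

theorem mainTheorem6 (p : ℕ) [Fact p.Prime] (g : ℕ) (hg : 1 ≤ g)
    (K : Type*) [Field K] [Finite K] [CharP K p] (hK : Nat.card K = p ^ g)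
    (k h i : ℤ) (m : ℕ) (hm : (m : ℤ) ≡ i + 1 [ZMOD (g : ℤ)]) :
    ModularRep.twist K p i (ModularRep.M K k) * ModularRep.twist K p (i + 1) (ModularRep.M K h)
        - (ModularRep.e K : ModularRep.K0 K (GL (Fin 2) K)) ^ p ^ m *
          (ModularRep.twist K p i (ModularRep.M K (k - p)) *
            ModularRep.twist K p (i + 1) (ModularRep.M K (h - 1)))
      = ModularRep.twist K p i (ModularRep.M K (k - p)) *
          ModularRep.twist K p (i + 1) (ModularRep.M K (h + 1))
        - (ModularRep.e K : ModularRep.K0 K (GL (Fin 2) K)) ^ p ^ m *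
          (ModularRep.twist K p i (ModularRep.M K (k - 2 * p)) *
            ModularRep.twist K p (i + 1) (ModularRep.M K h)) := by
  rw [← ModularRep.twist_e K p hK hm]
  have h1 := congrArg (ModularRep.twist K p i) (ModularRep.M_frobenius_relation K p k)
  have h2 := congrArg (ModularRep.twist K p (i + 1)) (ModularRep.M_add_one K h)
  simp only [map_add, map_sub, map_mul, map_zero, ← ModularRep.twist_add] at h1 h2
  -- The multipliers are chosen so that the products containing `M_1^{[i+1]}` cancel.
  linear_combination ModularRep.twist K p (i + 1) (ModularRep.M K h) * h1 -
    ModularRep.twist K p i (ModularRep.M K (k - p)) * h2
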